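/- Let $G=(V,E)$ be a finite simple undirected graph. For $S\subseteq V$ let $E[S]$ be the set of edges with both ends in $S$, let $G[S]$ be the subgraph induced by $S$, and for $u\in S$ let $d_S(u)$ be the degree of $u$ in $G[S]$. A feedback vertex set (FVS) of $G$ is a set $F\subseteq V$ such that $G-F$ is acyclic. Define $$P_{\mathrm{WD}}(G)=\Big\{x\in\mathbb R^V_{\ge 0}:\ \sum_{u\in S}(d_S(u)-1)x_u\ge |E[S]|-|S|\ \ \forall S\subseteq V\Big\},$$ $$P_{\text{cycle-cover}}(G)=\Big\{x\in\mathbb R^V_{\ge 0}:\ \sum_{u\in U}x_u\ge 1\ \ \forall U\subseteq V\text{ such that } G[U]\text{ is a cycle}\Big\}.$$ For every finite simple graph $G=(V,E)$ and all costs $c:V\to\mathbb R_{\ge 0}$, the problem $$\min\Big\{\sum_{u\in V}c_ux_u:\ x\in P_{\mathrm{WD}}(G)\cap P_{\text{cycle-cover}}(G)\cap\mathbb Z^V\Big\}$$ is an integer linear programming formulation of the minimum-cost FVS problem: its feasible solutions are exactly the characteristic vectors of the feedback vertex sets of $G$, and its optimum value is the minimum cost $\sum_{u\in F}c_u$ of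 an FVS $F$. Moreover: 1. The integrality gap of the LP relaxation $\min\{\sum_{u\in V}c_ux_u:\ x\in P_{\mathrm{WD}}(G)\cap P_{\text{cycle-cover}}(G)\}$ is at most $2$: for every $G$ and every $c\ge 0$ both minima are attained, and the integer minimum is at most twice the minimum of the relaxation. 2. $P_{\text{cycle-cover}}(G)$ has a polynomial-sized (extended) formulation: there is a polynomial $p$ such that for every finite simple graph $G=(V,E)$ there is a system of linear inequalities with integer coefficients in the variables $x\in\mathbb R^V$ and finitely many auxiliary variables, whose solution set projects to $P_{\text{cycle-cover}}(G)$ in the $x$-variables, and whose total size (number of variables, number of constraints, and encoding length of all coefficients) is at most $p(|V|)$. -/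

import Mathlib

universe u

noncomputable section

namespace FVS

variable {V : Type u}

/-- `F` is a feedback vertex set of `G`: deleting `F` leaves an acyclic graph. -/
def IsFeedbackVertexSet (G : SimpleGraph V) (F : Finset V) : Prop :=
  (G.induce ((F : Set V)ᶜ)).IsAcyclic

open Classical in
/-- The characteristic vector of a set of vertices. -/
def charVec (F : Finset V) : V → ℝ := fun u => if u ∈ F then 1 else 0

open Classical in
/-- `d_S(u)`: the number of neighbours of `u` inside `S`
(for `u ∈ S`, the degree of `u` in `G[S]`). -/
def degIn (G : SimpleGraph V) (S : Finset V) (u : V) : ℕ :=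
  (S.filter (fun v => G.Adj u v)).card

/-- `|E[S]|`: the number of edges of `G` with both ends in `S`. -/
def numEdgesIn (G : SimpleGraph V) (S : Finset V) : ℕ :=
  {e ∈ G.edgeSet | ∀ v ∈ e, v ∈ S}.ncard

/-- `G[U]` is a cycle: it is connected and each of its vertices has degree two. -/
def InducesCycle (G : SimpleGraph V) (U : Finset V) : Prop :=
  (G.induce (U : Set V)).Connected ∧ ∀ u ∈ U, degIn G U u = 2

/-- The weak density polyhedron. -/
def weakDensity (G : SimpleGraph V) : Set (V → ℝ) :=
  {x | (∀ u, 0 ≤ x u) ∧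
    ∀ S : Finset V,
      (numEdgesIn G S : ℝ) - (S.card : ℝ) ≤ ∑ u ∈ S, ((degIn G S u : ℝ) - 1) * x u}

/-- The cycle cover polyhedron. -/
def cycleCover (G : SimpleGraph V) : Set (V → ℝ) :=
  {x | (∀ u, 0 ≤ x u) ∧ ∀ U : Finset V, InducesCycle G U → 1 ≤ ∑ u ∈ U, x u}

/-- The integer vectors `ℤ^V` inside `ℝ^V`. -/
def integerVectors (V : Type u) : Set (V → ℝ) :=
  {x | ∀ u, ∃ k : ℤ, x u = (k : ℝ)}

/-- The objective function `∑ u, c u * x u`. -/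
def objective [Fintype V] (c x : V → ℝ) : ℝ := ∑ u, c u * x u

/-- `z` is the minimum (attained) of `∑ u, c u * x u` over `x ∈ P`. -/
def IsMinValue [Fintype V] (c : V → ℝ) (P : Set (V → ℝ)) (z : ℝ) : Prop :=
  IsLeast (objective c '' P) z

/-- `z` is the minimum (attained) cost of a feedback vertex set of `G`. -/
def IsMinFVSCost (G : SimpleGraph V) (c : V → ℝ) (z : ℝ) : Prop :=
  IsLeast {t | ∃ F : Finset V, IsFeedbackVertexSet G F ∧ t = ∑ u ∈ F, c u} z

/-- `min {∑ u, c u * x u : x ∈ P ∩ ℤ^V}` is an integer linear programming formulation of the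
feedback vertex set problem on `(G, c)`: its feasible solutions are exactly the characteristic
vectors of the feedback vertex sets of `G`, and its optimum value is the minimum cost of a
feedback vertex set. -/
def IsILPFormulation [Fintype V] (G : SimpleGraph V) (c : V → ℝ) (P : Set (V → ℝ)) : Prop :=
  P ∩ integerVectors V = {x | ∃ F : Finset V, IsFeedbackVertexSet G F ∧ x = charVec F} ∧
  ∃ z : ℝ, IsMinValue c (P ∩ integerVectors V) z ∧ IsMinFVSCost G c z

/-- For the objective `c`, both `min {∑ u, c u * x u : x ∈ P ∩ ℤ^V}` and its relaxation
`min {∑ u, c u * x u : x ∈ P}` are attained, and the former is at most `α` times the latter. -/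
def IntegralityGapLE [Fintype V] (c : V → ℝ) (P : Set (V → ℝ)) (α : ℝ) : Prop :=
  ∃ zIP zLP : ℝ, IsMinValue c (P ∩ integerVectors V) zIP ∧ IsMinValue c P zLP ∧ zIP ≤ α * zLP

/-- A finite system of linear inequalities with integer coefficients in the variables
`x ∈ ℝ^V` and finitely many auxiliary variables `y`:
`∑ v, A i v * x v + ∑ j, B i j * y j ≥ b i` for every constraint `i`. -/
structure ExtendedFormulation (V : Type u) where
  /-- index set of the auxiliary variables -/
  Aux : Type u
  /-- index set of the constraints -/
  Con : Type u
  [fintypeAux : Fintype Aux]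
  [fintypeCon : Fintype Con]
  A : Con → V → ℤ
  B : Con → Aux → ℤ
  b : Con → ℤ

attribute [instance] ExtendedFormulation.fintypeAux ExtendedFormulation.fintypeCon

/-- The projection to the `x` variables of the polyhedron that the system describes. -/
def ExtendedFormulation.projection [Fintype V] (Φ : ExtendedFormulation V) : Set (V → ℝ) :=
  {x | ∃ y : Φ.Aux → ℝ, ∀ i : Φ.Con,
    (Φ.b i : ℝ) ≤ ∑ v, (Φ.A i v : ℝ) * x v + ∑ j, (Φ.B i j : ℝ) * y j}

/-- Encoding length of an integer: a sign bit and the binary digits of its absolute value. -/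
def intSize (k : ℤ) : ℕ := 1 + k.natAbs.size

/-- The size of a system: the number of its variables and constraints plus the total encoding
length of all its coefficients and right-hand sides. -/
def ExtendedFormulation.size [Fintype V] (Φ : ExtendedFormulation V) : ℕ :=
  (Fintype.card V + Fintype.card Φ.Aux) + Fintype.card Φ.Con +
    ∑ i : Φ.Con, ((∑ v, intSize (Φ.A i v)) + (∑ j, intSize (Φ.B i j)) + intSize (Φ.b i))

end FVS

end

open Finset
open scoped Classical

namespace FVS

variable {V : Type u} {G : SimpleGraph V}

/-! ### Degrees and edges inside a set -/

/-! The gap bound is a local ratio argument run against a fixed feasible point `x`. For a vertex set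
`W` and costs `c ≥ 0`, induction on `W` yields an inclusionwise minimal FVS `F` of `G[W]` with `c(F)
≤ 2 ∑ c x` over `W` (`exists_minimalFVS_le_two_mul`). Vertices of degree at most one are discarded.
Otherwise a weighting `g` is subtracted from `c` until some vertex costs nothing; that vertex is
deleted, and put back only if a cycle would survive. It remains to find `g` with `g(F) ≤ 2 ∑ g x`
for every minimal `F` (`exists_good_weights`).

If some cycle `U` has all but one of its vertices of degree two in `G[W]` (a semidisjoint cycle),
`g` is the indicator of `U`: a minimal FVS meets `U` at most once, while cycle cover gives `x(U) ≥
1`. If there is none, `g = d_W - 1`: weak density gives `∑ g x ≥ |E[W]| - |W|`, and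
`IsMinimalFVS.sum_degIn_add_le` gives `g(F) ≤ 2 (|E[W]| - |W|)` by counting edges between `F` and
the components of the remaining forest.

Acyclicity is handled throughout as the absence of a core, a nonempty induced subgraph of minimum
degree two; a minimal core is an induced cycle.

For the extended formulation, each ordered edge `st` gets potentials that act as vertex-weighted
distances from `s` avoiding the step to `t`. Requiring the potential of `t` to be at least one says
that every cycle through `st` has weight at least one. -/

theorem degIn_mono {S T : Finset V} (h : S ⊆ T) (u : V) : degIn G S u ≤ degIn G T u :=
  card_le_card (filter_subset_filter _ h)

theorem degIn_insert {S : Finset V} {v : V} (hv : v ∉ S) (u : V) :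
    degIn G (insert v S) u = degIn G S u + if G.Adj u v then 1 else 0 := by
  unfold degIn
  rw [filter_insert]
  split_ifs with h
  · rw [card_insert_of_notMem (by simp [hv])]
  · rfl

theorem degIn_insert_self {S : Finset V} {v : V} : degIn G (insert v S) v = degIn G S v := by
  unfold degIn
  rw [filter_insert, if_neg (G.loopless.irrefl v)]

theorem degIn_union {S T : Finset V} (h : Disjoint S T) (u : V) :
    degIn G (S ∪ T) u = degIn G S u + degIn G T u := by
  unfold degIn
  rw [filter_union, card_union_of_disjoint (disjoint_filter_filter h)]

theorem degIn_eq_sum (S : Finset V) (u : V) :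
    degIn G S u = ∑ v ∈ S, if G.Adj u v then 1 else 0 := by
  unfold degIn
  rw [card_filter]

theorem sum_degIn_comm (S T : Finset V) :
    ∑ u ∈ S, degIn G T u = ∑ v ∈ T, degIn G S v := by
  simp_rw [degIn_eq_sum]
  rw [sum_comm]
  simp_rw [G.adj_comm]

theorem degIn_pos_iff {S : Finset V} {u : V} : 0 < degIn G S u ↔ ∃ v ∈ S, G.Adj u v := by
  unfold degIn
  rw [card_pos]
  simp [Finset.Nonempty]

theorem degIn_congr {S T : Finset V} {u : V} (h : ∀ w, G.Adj u w → (w ∈ S ↔ w ∈ T)) :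
    degIn G S u = degIn G T u := by
  unfold degIn
  congr 1
  ext w
  simp only [mem_filter]
  constructor
  · rintro ⟨h1, h2⟩
    exact ⟨(h w h2).1 h1, h2⟩
  · rintro ⟨h1, h2⟩
    exact ⟨(h w h2).2 h1, h2⟩

theorem numEdgesIn_empty : numEdgesIn G ∅ = 0 := by
  unfold numEdgesIn
  have : {e ∈ G.edgeSet | ∀ v ∈ e, v ∈ (∅ : Finset V)} = ∅ := by
    refine Set.eq_empty_of_forall_notMem ?_
    rintro e ⟨-, he⟩
    induction e with | _ a b => exact absurd (he a (by simp)) (by simp)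
  rw [this, Set.ncard_empty]

theorem finite_edgesIn (S : Finset V) : {e ∈ G.edgeSet | ∀ v ∈ e, v ∈ S}.Finite := by
  refine S.sym2.finite_toSet.subset ?_
  rintro e ⟨-, he⟩
  exact Finset.mem_coe.2 (Finset.mem_sym2_iff.2 he)

theorem numEdgesIn_insert {S : Finset V} {v : V} (hv : v ∉ S) :
    numEdgesIn G (insert v S) = numEdgesIn G S + degIn G S v := by
  unfold numEdgesIn
  have hset : {e ∈ G.edgeSet | ∀ w ∈ e, w ∈ insert v S} =
      {e ∈ G.edgeSet | ∀ w ∈ e, w ∈ S} ∪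
        (((S.filter (fun w => G.Adj v w)).image (fun w => s(v, w)) : Finset (Sym2 V)) :
          Set (Sym2 V)) := by
    ext e
    induction e with
    | _ a b =>
      simp only [Set.mem_ofPred_eq, SimpleGraph.mem_edgeSet, Sym2.mem_iff, forall_eq_or_imp,
        forall_eq, mem_insert, Set.mem_union, coe_image, Set.mem_image, coe_filter, Sym2.eq_iff]
      constructor
      · rintro ⟨h, rfl | ha, rfl | hb⟩
        · exact absurd h (G.loopless.irrefl _)
        · exact Or.inr ⟨b, ⟨hb, h⟩, by simp⟩
        · exact Or.inr ⟨a, ⟨ha, h.symm⟩, by simp⟩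
        · exact Or.inl ⟨h, ha, hb⟩
      · rintro (⟨h, ha, hb⟩ | ⟨w, ⟨hw, hvw⟩, ⟨rfl, rfl⟩ | ⟨rfl, rfl⟩⟩)
        · exact ⟨h, Or.inr ha, Or.inr hb⟩
        · exact ⟨hvw, Or.inl rfl, Or.inr hw⟩
        · exact ⟨hvw.symm, Or.inr hw, Or.inl rfl⟩
  rw [hset, Set.ncard_union_eq ?_ (finite_edgesIn S) (Finset.finite_toSet _),
    Set.ncard_coe_finset, card_image_of_injective]
  · rfl
  · intro a b hab
    exact Sym2.congr_right.1 hab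
  · rw [Set.disjoint_left]
    rintro e ⟨-, he⟩ h2
    simp only [coe_image, Set.mem_image] at h2
    obtain ⟨w, -, rfl⟩ := h2
    exact hv (he v (by simp))

theorem sum_degIn (S : Finset V) : ∑ u ∈ S, degIn G S u = 2 * numEdgesIn G S := by
  induction S using Finset.induction_on with
  | empty => simp [numEdgesIn_empty]
  | insert v S hv ih =>
    rw [sum_insert hv, degIn_insert_self, numEdgesIn_insert hv]
    simp_rw [degIn_insert hv, sum_add_distrib, ih, degIn_eq_sum S v, G.adj_comm v]
    ring

theorem numEdgesIn_erase {S : Finset V} {v : V} (hv : v ∈ S) :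
    numEdgesIn G S = numEdgesIn G (S.erase v) + degIn G S v := by
  conv_lhs => rw [← insert_erase hv]
  rw [numEdgesIn_insert (by simp)]
  conv_rhs => rw [← insert_erase hv, degIn_insert_self]
  simp

theorem numEdgesIn_union {S T : Finset V} (h : Disjoint S T) :
    numEdgesIn G (S ∪ T) = numEdgesIn G S + numEdgesIn G T + ∑ u ∈ S, degIn G T u := by
  have h1 := sum_degIn (G := G) (S ∪ T)
  rw [sum_union h] at h1
  simp_rw [degIn_union h, sum_add_distrib, sum_degIn, sum_degIn_comm T S] at h1
  omega

/-- Every edge in `S` either meets `A`, and is then counted once or twice by the degrees, or avoids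
it. This is the source of weak density for characteristic vectors. -/
theorem numEdgesIn_le_sum_degIn_add {S A : Finset V} (h : A ⊆ S) :
    numEdgesIn G S ≤ ∑ u ∈ A, degIn G S u + numEdgesIn G (S \ A) := by
  have h1 := numEdgesIn_union (G := G) (disjoint_sdiff (s := A) (t := S))
  have h2 := sum_degIn (G := G) A
  rw [union_sdiff_of_subset h] at h1
  have h3 : ∑ u ∈ A, degIn G S u = ∑ u ∈ A, degIn G A u + ∑ u ∈ A, degIn G (S \ A) u := by
    rw [← sum_add_distrib]
    refine sum_congr rfl fun u _ => ?_
    rw [← degIn_union disjoint_sdiff, union_sdiff_of_subset h]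
  omega

/-! ### Closed subsets and connectedness -/

/-- `Y` is a union of connected components of `G[X]`. -/
def ClosedIn (G : SimpleGraph V) (X Y : Finset V) : Prop :=
  Y ⊆ X ∧ ∀ v ∈ Y, ∀ w ∈ X, G.Adj v w → w ∈ Y

theorem ClosedIn.inter {X Y Z : Finset V} (hY : ClosedIn G X Y) (hZ : ClosedIn G X Z) :
    ClosedIn G X (Y ∩ Z) :=
  ⟨inter_subset_left.trans hY.1, fun v hv w hw h => by
    rw [mem_inter] at hv ⊢
    exact ⟨hY.2 v hv.1 w hw h, hZ.2 v hv.2 w hw h⟩⟩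

theorem ClosedIn.sdiff {X Y Z : Finset V} (hY : ClosedIn G X Y) (hZ : ClosedIn G X Z) :
    ClosedIn G X (Y \ Z) :=
  ⟨sdiff_subset.trans hY.1, fun v hv w hw h => by
    rw [mem_sdiff] at hv ⊢
    exact ⟨hY.2 v hv.1 w hw h, fun hwZ => hv.2 (hZ.2 w hwZ v (hY.1 hv.1) h.symm)⟩⟩

theorem ClosedIn.degIn_eq {X Y : Finset V} (hY : ClosedIn G X Y) {v : V} (hv : v ∈ Y) :
    degIn G Y v = degIn G X v :=
  degIn_congr fun w hw => ⟨fun h => hY.1 h, fun h => hY.2 v hv w h hw⟩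

/-- `G[X]` is connected, expressed by cuts. -/
def CutConnected (G : SimpleGraph V) (X : Finset V) : Prop :=
  X.Nonempty ∧ ∀ Y, ClosedIn G X Y → Y.Nonempty → Y = X

/-- The cut form of connectedness suits the extremal arguments below: a largest good subset that is
not everything has an edge leaving it. -/
theorem connected_induce_iff {X : Finset V} :
    (G.induce (X : Set V)).Connected ↔ CutConnected G X := by
  constructor
  · intro h
    obtain ⟨x0⟩ := h.nonempty
    refine ⟨⟨x0.1, x0.2⟩, fun Y hY ⟨y, hy⟩ => hY.1.antisymm fun x hx => ?_⟩
    have hreach := h.preconnected ⟨y, hY.1 hy⟩ ⟨x, hx⟩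
    obtain ⟨p⟩ := hreach
    have key : ∀ a b : (X : Set V), (G.induce (X : Set V)).Walk a b → a.1 ∈ Y → b.1 ∈ Y := by
      intro a b p
      induction p with
      | nil => exact id
      | cons hab _ ih => exact fun ha => ih (hY.2 _ ha _ (by simp) hab)
    exact key _ _ p hy
  · rintro ⟨⟨x0, hx0⟩, h⟩
    rw [SimpleGraph.connected_iff_exists_forall_reachable]
    refine ⟨⟨x0, hx0⟩, ?_⟩
    have := h (X.filter fun w => ∃ hw : w ∈ X,
      (G.induce (X : Set V)).Reachable ⟨x0, hx0⟩ ⟨w, hw⟩) ⟨filter_subset _ _, ?_⟩ ⟨x0, ?_⟩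
    · rintro ⟨w, hw⟩
      have hw' : w ∈ X := hw
      rw [← this, mem_filter] at hw'
      exact hw'.2.2
    · intro v hv w hw hvw
      rw [mem_filter] at hv ⊢
      obtain ⟨_, hvX, hr⟩ := hv
      refine ⟨hw, hw, hr.trans (SimpleGraph.Adj.reachable ?_)⟩
      simpa using hvw
    · rw [mem_filter]
      exact ⟨hx0, hx0, SimpleGraph.Reachable.refl _⟩

/-- Growing a subset one adjacent vertex at a time gains at least one edge per vertex. -/
theorem CutConnected.card_le {X : Finset V} (h : CutConnected G X) :
    X.card ≤ numEdgesIn G X + 1 := by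
  obtain ⟨x0, hx0⟩ := h.1
  let P := X.powerset.filter fun R => R.Nonempty ∧ R.card ≤ numEdgesIn G R + 1
  have hP : P.Nonempty := ⟨{x0}, by simp [P, hx0]⟩
  obtain ⟨R, hR, hmax⟩ := P.exists_max_image card hP
  simp only [P, mem_filter, mem_powerset] at hR hmax
  by_cases hRX : R = X
  · rw [← hRX]; exact hR.2.2
  have : ¬ ClosedIn G X R := fun hc => hRX (h.2 R hc hR.2.1)
  simp only [ClosedIn, not_and, not_forall] at this
  obtain ⟨v, hv, w, hw, hvw, hwR⟩ := this hR.1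
  have h1 := hmax (insert w R) ⟨insert_subset hw hR.1, by simp, by
    rw [card_insert_of_notMem hwR, numEdgesIn_insert hwR]
    have : 0 < degIn G R w := degIn_pos_iff.2 ⟨v, hv, hvw.symm⟩
    omega⟩
  rw [card_insert_of_notMem hwR] at h1
  omega

/-! ### Acyclic sets -/

/-- `G[S]` is nonempty with minimum degree at least two. -/
def IsCore (G : SimpleGraph V) (S : Finset V) : Prop :=
  S.Nonempty ∧ ∀ v ∈ S, 2 ≤ degIn G S v

/-- `G[X]` has no nonempty induced subgraph of minimum degree at least two. -/
def CoreFree (G : SimpleGraph V) (X : Finset V) : Prop := ∀ S ⊆ X, ¬ IsCore G S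

theorem CoreFree.mono {X Y : Finset V} (h : CoreFree G Y) (hXY : X ⊆ Y) : CoreFree G X :=
  fun S hS => h S (hS.trans hXY)

/-- Repeatedly peel off a vertex of degree at most one; the last vertex takes no edge with it, hence
strictness. -/
theorem CoreFree.numEdgesIn_lt {X : Finset V} (h : CoreFree G X) (hX : X.Nonempty) :
    numEdgesIn G X < X.card := by
  induction X using Finset.strongInduction with
  | H X ih =>
    have := h X Subset.rfl
    simp only [IsCore, not_and, not_forall, not_le] at this
    obtain ⟨v, hv, hd⟩ := this hX
    rw [numEdgesIn_erase hv]
    have hc := card_erase_add_one hv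
    rcases (X.erase v).eq_empty_or_nonempty with he | he
    · have hX1 : X = {v} := by rw [← insert_erase hv, he]; rfl
      subst hX1
      simp only [erase_singleton, numEdgesIn_empty, card_singleton]
      have : degIn G {v} v = 0 := by simp [degIn]
      omega
    · have := ih _ (erase_ssubset hv) (h.mono (erase_subset _ _)) he
      omega

theorem CoreFree.numEdgesIn_le {X : Finset V} (h : CoreFree G X) :
    numEdgesIn G X ≤ X.card := by
  rcases X.eq_empty_or_nonempty with rfl | hX
  · simp [numEdgesIn_empty]
  · exact (h.numEdgesIn_lt hX).le

/-- An inclusionwise minimal core is a cycle. It is connected because a closed part of a core is a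
core. It has a vertex of degree two, since otherwise any vertex could be deleted. Removing that
vertex leaves a core-free set, so there are at most as many edges as vertices, and all degrees equal
two. -/
theorem IsCore.exists_inducesCycle {S : Finset V} (h : IsCore G S) :
    ∃ U ⊆ S, InducesCycle G U := by
  induction S using Finset.strongInduction with
  | H S ih =>
    by_cases hmin : ∃ T ⊂ S, IsCore G T
    · obtain ⟨T, hT, hc⟩ := hmin
      obtain ⟨U, hU, hUc⟩ := ih T hT hc
      exact ⟨U, hU.trans hT.1, hUc⟩
    push Not at hmin
    refine ⟨S, Subset.rfl, ?_, ?_⟩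
    · rw [connected_induce_iff]
      refine ⟨h.1, fun Y hY hne => by_contra fun hYS => ?_⟩
      refine hmin Y (hY.1.ssubset_of_ne hYS) ⟨hne, fun v hv => ?_⟩
      rw [hY.degIn_eq hv]
      exact h.2 v (hY.1 hv)
    · have hge := h.2
      obtain ⟨v, hv⟩ := h.1
      have hne : (S.erase v).Nonempty := by
        have h2 := hge v hv
        obtain ⟨w, hw, hvw⟩ := degIn_pos_iff.1 (show 0 < degIn G S v by omega)
        exact ⟨w, mem_erase.2 ⟨hvw.ne', hw⟩⟩
      have hdeg2 : ∃ w ∈ S, degIn G S w = 2 := by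
        by_contra hno
        push Not at hno
        refine hmin _ (erase_ssubset hv) ⟨hne, fun w hw => ?_⟩
        rw [mem_erase] at hw
        have h3 := hge w hw.2
        have h4 := hno w hw.2
        have h5 : degIn G S w = degIn G (S.erase v) w + if G.Adj w v then 1 else 0 := by
          rw [← degIn_insert (by simp), insert_erase hv]
        split_ifs at h5 <;> omega
      obtain ⟨w, hw, hdw⟩ := hdeg2
      have hcf : CoreFree G (S.erase w) := fun T hT => hmin T (hT.trans_ssubset (erase_ssubset hw))
      have h1 := numEdgesIn_erase (G := G) hw
      have hne' : (S.erase w).Nonempty := by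
        obtain ⟨w', hw', hvw⟩ := degIn_pos_iff.1 (show 0 < degIn G S w by omega)
        exact ⟨w', mem_erase.2 ⟨hvw.ne', hw'⟩⟩
      have h2 := hcf.numEdgesIn_lt hne'
      have h3 := card_erase_add_one hw
      have h4 := sum_degIn (G := G) S
      have h5 : ∑ u ∈ S, degIn G S u ≤ ∑ u ∈ S, 2 := by
        rw [sum_const, smul_eq_mul]
        omega
      exact fun u hu => (((sum_eq_sum_iff_of_le hge).1
        (le_antisymm (sum_le_sum hge) h5)) u hu).symm

theorem InducesCycle.isCore {U : Finset V} (h : InducesCycle G U) : IsCore G U :=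
  ⟨(connected_induce_iff.1 h.1).1, fun v hv => (h.2 v hv).ge⟩

theorem not_coreFree_iff {X : Finset V} :
    ¬ CoreFree G X ↔ ∃ U ⊆ X, InducesCycle G U := by
  constructor
  · intro h
    simp only [CoreFree, not_forall, not_not] at h
    obtain ⟨S, hS, hc⟩ := h
    obtain ⟨U, hU, hUc⟩ := hc.exists_inducesCycle
    exact ⟨U, hU.trans hS, hUc⟩
  · rintro ⟨U, hU, hUc⟩ h
    exact h U hU hUc.isCore

/-- A tree with at least two vertices has a leaf. -/
theorem InducesCycle.not_isAcyclic {U : Finset V} (h : InducesCycle G U) :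
    ¬ (G.induce (U : Set V)).IsAcyclic := by
  intro hac
  have htree : (G.induce (U : Set V)).IsTree := ⟨h.1, hac⟩
  obtain ⟨u, hu⟩ := h.isCore.1
  obtain ⟨w, hw, huw⟩ := degIn_pos_iff.1 (show 0 < degIn G U u by rw [h.2 u hu]; omega)
  have : Nontrivial (U : Set V) := ⟨⟨⟨u, hu⟩, ⟨w, hw⟩, fun he => huw.ne (congrArg Subtype.val he)⟩⟩
  obtain ⟨v, hv⟩ := htree.exists_vert_degree_one_of_nontrivial
  have h2 := h.2 v.1 v.2
  rw [← SimpleGraph.card_neighborFinset_eq_degree] at hv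
  have : degIn G U v.1 = ((G.induce (U : Set V)).neighborFinset v).card := by
    unfold degIn
    rw [← card_map (Function.Embedding.subtype _)]
    congr 1
    ext x
    simp
    tauto
  omega

/-- The support of a cycle walk is a core: each of its vertices has two neighbours along the walk.
-/
theorem isAcyclic_of_coreFree {X : Set V} (h : ∀ S : Finset V, ↑S ⊆ X → ¬ IsCore G S) :
    (G.induce X).IsAcyclic := by
  intro v p hp
  refine h (p.support.toFinset.map (Function.Embedding.subtype _)) ?_ ⟨⟨v.1, ?_⟩, ?_⟩
  · intro x hx
    simp only [coe_map, Function.Embedding.subtype_apply, List.coe_toFinset, Set.mem_image,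
      Set.mem_ofPred_eq] at hx
    obtain ⟨y, -, rfl⟩ := hx
    exact y.2
  · simp
  · intro w hw
    simp only [mem_map, List.mem_toFinset, Function.Embedding.subtype_apply] at hw
    obtain ⟨w, hw, rfl⟩ := hw
    have h2 := hp.ncard_neighborSet_toSubgraph_eq_two hw
    rw [← h2, ← Set.ncard_image_of_injective _ Subtype.val_injective]
    unfold degIn
    rw [← Set.ncard_coe_finset]
    refine Set.ncard_le_ncard ?_ (Finset.finite_toSet _)
    rintro _ ⟨x, hx, rfl⟩
    have hadj := (p.toSubgraph).adj_sub hx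
    have hmem : x ∈ p.support := by
      rw [← SimpleGraph.Walk.mem_verts_toSubgraph]
      exact (p.toSubgraph).edge_vert hx.symm
    simp only [coe_filter, mem_map, List.mem_toFinset, Set.mem_ofPred_eq]
    exact ⟨⟨x, hmem, rfl⟩, hadj⟩

theorem isFeedbackVertexSet_iff [Fintype V] {F : Finset V} :
    IsFeedbackVertexSet G F ↔ CoreFree G (univ \ F) := by
  constructor
  · intro h
    by_contra hc
    obtain ⟨U, hU, hUc⟩ := not_coreFree_iff.1 hc
    have hle : (U : Set V) ≤ (F : Set V)ᶜ := fun x hx => by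
      have := hU hx
      simpa using this
    exact hUc.not_isAcyclic (h.embedding (SimpleGraph.induceHomOfLE G hle))
  · intro h
    refine isAcyclic_of_coreFree fun S hS => h S fun x hx => ?_
    have := hS hx
    simpa using this

/-! ### Minimal feedback vertex sets -/

/-- `F` is an inclusionwise minimal feedback vertex set of `G[W]`. -/
structure IsMinimalFVS (G : SimpleGraph V) (W F : Finset V) : Prop where
  subset : F ⊆ W
  coreFree : CoreFree G (W \ F)
  minimal : ∀ u ∈ F, ¬ CoreFree G (insert u (W \ F))

/-- A proper part of an induced cycle is left by at least two edges. -/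
theorem InducesCycle.exists_exit {U Q : Finset V} (hU : InducesCycle G U) (hQU : Q ⊆ U)
    (hne : Q.Nonempty) (hQ : Q ≠ U) (a₀ b₀ : V) :
    ∃ a ∈ Q, ∃ b ∈ U, b ∉ Q ∧ G.Adj a b ∧ ¬ (a = a₀ ∧ b = b₀) := by
  by_contra hno
  push Not at hno
  have hnc : ¬ ClosedIn G U Q := fun hc => hQ ((connected_induce_iff.1 hU.1).2 Q hc hne)
  simp only [ClosedIn, not_and, not_forall] at hnc
  obtain ⟨a, ha, b, hb, hab, hbQ⟩ := hnc hQU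
  obtain ⟨rfl, rfl⟩ := hno a ha b hb hbQ hab
  -- If a single edge left `Q`, the degree sum `2 |Q|` would equal `2 |E[Q]| + 1`, against parity.
  have hout : ∑ v ∈ Q, degIn G (U \ Q) v = 1 := by
    rw [sum_eq_single_of_mem a ha]
    · unfold degIn
      rw [card_eq_one]
      refine ⟨b, ?_⟩
      ext w
      simp only [mem_filter, mem_sdiff, mem_singleton]
      constructor
      · rintro ⟨⟨hw, hwQ⟩, haw⟩
        exact (hno a ha w hw hwQ haw).2
      · rintro rfl
        exact ⟨⟨hb, hbQ⟩, hab⟩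
    · intro v hv hva
      by_contra hpos
      obtain ⟨w, hw, hvw⟩ := degIn_pos_iff.1 (Nat.pos_of_ne_zero hpos)
      rw [mem_sdiff] at hw
      exact hva (hno v hv w hw.1 hw.2 hvw).1
  have hsum : ∑ v ∈ Q, degIn G U v = 2 * Q.card := by
    rw [sum_congr rfl fun v hv => hU.2 v (hQU hv), sum_const, smul_eq_mul, mul_comm]
  have hsplit : ∑ v ∈ Q, degIn G U v = ∑ v ∈ Q, degIn G Q v + ∑ v ∈ Q, degIn G (U \ Q) v := by
    rw [← sum_add_distrib]
    refine sum_congr rfl fun v _ => ?_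
    rw [← degIn_union disjoint_sdiff, union_sdiff_of_subset hQU]
  rw [sum_degIn] at hsplit
  omega

theorem IsMinimalFVS.exists_core {W F : Finset V} (hF : IsMinimalFVS G W F) {u : V} (hu : u ∈ F) :
    ∃ S, S ⊆ insert u (W \ F) ∧ IsCore G S ∧ u ∈ S := by
  have h := hF.minimal u hu
  simp only [CoreFree, not_forall, not_not] at h
  obtain ⟨S, hS, hc⟩ := h
  refine ⟨S, hS, hc, by_contra fun huS => hF.coreFree S (fun x hx => ?_) hc⟩
  rcases mem_insert.1 (hS hx) with rfl | h
  · exact absurd hx huS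
  · exact h

/-- A minimal feedback vertex set meets a semidisjoint cycle at most once. -/
theorem IsMinimalFVS.card_inter_le_one {W F U : Finset V} (hF : IsMinimalFVS G W F)
    (hUW : U ⊆ W) (hU : InducesCycle G U) {u₀ : V}
    (hdeg : ∀ v ∈ U, v ≠ u₀ → degIn G W v = 2) : (F ∩ U).card ≤ 1 := by
  by_contra hcard
  have : ∃ a ∈ F ∩ U, ∃ b ∈ F ∩ U, a ≠ b ∧ a ≠ u₀ := by
    obtain ⟨a, ha, b, hb, hab⟩ := one_lt_card.1 (not_le.1 hcard)
    by_cases h : a = u₀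
    · exact ⟨b, hb, a, ha, hab.symm, fun h' => hab (h.trans h'.symm)⟩
    · exact ⟨a, ha, b, hb, hab, h⟩
  obtain ⟨a, ha, b, hb, hab, hau⟩ := this
  rw [mem_inter] at ha hb
  obtain ⟨S, hS, hcore, haS⟩ := hF.exists_core ha.1
  have hSW : S ⊆ W := hS.trans (insert_subset (hUW ha.2) sdiff_subset)
  have hbS : b ∉ S := fun h => by
    rcases mem_insert.1 (hS h) with h | h
    · exact hab h.symm
    · exact (mem_sdiff.1 h).2 hb.1
  -- A vertex of `S ∩ U` other than `u₀` has only two neighbours in `W`, and the core `S` needs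
  -- both. So `S` spreads along `U` and can stop only at `u₀`.
  have hnbr : ∀ v ∈ S ∩ U, v ≠ u₀ → ∀ w ∈ U, G.Adj v w → w ∈ S := by
    intro v hv hvu w hw hvw
    rw [mem_inter] at hv
    have h1 := hcore.2 v hv.1
    have h2 := hdeg v hv.2 hvu
    have h3 : S.filter (fun w => G.Adj v w) = W.filter (fun w => G.Adj v w) :=
      eq_of_subset_of_card_le (filter_subset_filter _ hSW) (h2.le.trans h1)
    have h4 : w ∈ W.filter (fun w => G.Adj v w) := mem_filter.2 ⟨hUW hw, hvw⟩
    rw [← h3] at h4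
    exact (mem_filter.1 h4).1
  have hQU : S ∩ U ⊆ U := inter_subset_right
  have hQne : S ∩ U ≠ U := fun h => hbS (mem_inter.1 (h.symm ▸ hb.2 : b ∈ S ∩ U)).1
  have haQ : a ∈ S ∩ U := mem_inter.2 ⟨haS, ha.2⟩
  have hexit : ∀ n, ∃ m ∈ U, m ∉ S ∩ U ∧ G.Adj u₀ m ∧ m ≠ n ∧ u₀ ∈ U := by
    intro n
    obtain ⟨v, hv, w, hw, hwQ, hvw, hne⟩ := hU.exists_exit hQU ⟨a, haQ⟩ hQne u₀ n
    have hvu : v = u₀ := by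
      by_contra hvu
      exact hwQ (mem_inter.2 ⟨hnbr v hv hvu w hw hvw, hw⟩)
    subst hvu
    exact ⟨w, hw, hwQ, hvw, fun h => hne ⟨rfl, h⟩, hQU hv⟩
  -- Two edges of the cycle leave `S ∩ U`, both at `u₀`; a third joins `u₀` to the rest of `S ∩ U`,
  -- which contains `a`. This exceeds degree two.
  obtain ⟨n, hn, hnQ, hun, -, hu₀⟩ := hexit u₀
  obtain ⟨m, hm, hmQ, hum, hmn, -⟩ := hexit n
  obtain ⟨v, hv, w, hw, hwQ, hvw, -⟩ := hU.exists_exit ((erase_subset u₀ _).trans hQU)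
    ⟨a, mem_erase.2 ⟨hau, haQ⟩⟩ (fun h => hQne (hQU.antisymm (h.symm.subset.trans (erase_subset _ _)))) u₀ u₀
  rw [mem_erase] at hv
  have hwu : w = u₀ := by
    by_contra hwu
    exact hwQ (mem_erase.2 ⟨hwu, mem_inter.2 ⟨hnbr v hv.2 hv.1 w hw hvw, hw⟩⟩)
  subst hwu
  have h3 : ({n, m, v} : Finset V) ⊆ U.filter (fun x => G.Adj w x) := by
    intro x hx
    simp only [mem_insert, mem_singleton] at hx
    rcases hx with rfl | rfl | rfl
    · exact mem_filter.2 ⟨hn, hun⟩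
    · exact mem_filter.2 ⟨hm, hum⟩
    · exact mem_filter.2 ⟨hQU hv.2, hvw.symm⟩
  have h4 := card_le_card h3
  have h5 : (U.filter (fun x => G.Adj w x)).card = 2 := hU.2 w hw
  rw [h5, card_insert_of_notMem, card_insert_of_notMem, card_singleton] at h4
  · omega
  · rw [mem_singleton]
    rintro rfl
    exact hmQ hv.2
  · simp only [mem_insert, mem_singleton, not_or]
    exact ⟨hmn.symm, fun h => hnQ (h ▸ hv.2)⟩

/-- Every vertex of a minimal feedback vertex set sends two edges to one component of the
remaining forest. -/
theorem IsMinimalFVS.exists_anchor {W F : Finset V} (hF : IsMinimalFVS G W F) {u : V}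
    (hu : u ∈ F) :
    ∃ t ∈ W \ F, ∀ Y, ClosedIn G (W \ F) Y → t ∈ Y → 2 ≤ degIn G Y u := by
  obtain ⟨S, hS, hcore, huS⟩ := hF.exists_core hu
  obtain ⟨t, htS, hut⟩ := degIn_pos_iff.1 (show 0 < degIn G S u by have := hcore.2 u huS; omega)
  have hSX : ∀ x ∈ S, x ≠ u → x ∈ W \ F := fun x hx hxu => (mem_insert.1 (hS hx)).resolve_left hxu
  refine ⟨t, hSX t htS hut.ne', fun Y hY htY => by_contra fun hlt => ?_⟩
  have huY : u ∉ Y := fun h => (mem_sdiff.1 (hY.1 h)).2 hu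
  have huZ : u ∉ S ∩ Y := fun h => huY (mem_inter.1 h).2
  -- Inside `Y` the core loses only its edges to `u`. With at most one such edge, the degree sum
  -- gives at least `|S ∩ Y|` edges on `S ∩ Y`, impossible in a forest.
  have h1 : ∀ v ∈ S ∩ Y, 2 ≤ degIn G (S ∩ Y) v + if G.Adj v u then 1 else 0 := by
    intro v hv
    rw [mem_inter] at hv
    rw [← degIn_insert huZ]
    refine (hcore.2 v hv.1).trans (degIn_congr fun w hvw => ?_).le
    rw [mem_insert, mem_inter]
    constructor
    · intro hw
      by_cases hwu : w = u
      · exact Or.inl hwu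
      · exact Or.inr ⟨hw, hY.2 v hv.2 w (hSX w hw hwu) hvw⟩
    · rintro (rfl | h)
      · exact huS
      · exact h.1
  have h2 := sum_le_sum h1
  rw [sum_add_distrib, sum_degIn, sum_const, smul_eq_mul] at h2
  simp_rw [fun v => G.adj_comm v u] at h2
  rw [← degIn_eq_sum] at h2
  have h3 := (hF.coreFree.mono (inter_subset_right.trans hY.1 : S ∩ Y ⊆ W \ F)).numEdgesIn_lt
    ⟨t, mem_inter.2 ⟨htS, htY⟩⟩
  have h4 := degIn_mono (G := G) (inter_subset_right : S ∩ Y ⊆ Y) u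
  omega

/-- The edge count for one component `T` of the forest that a feedback vertex set leaves. -/
theorem card_anchored_add_le {X F T : Finset V} (hXF : Disjoint F X) (hT : ClosedIn G X T)
    (hconn : CutConnected G T) (hdeg : ∀ v ∈ T, 2 ≤ degIn G F v + degIn G X v) {A : Finset V}
    (hAF : A ⊆ F) (hA : ∀ u ∈ A, 2 ≤ degIn G T u)
    (hcyc : ∀ U ⊆ F ∪ X, InducesCycle G U →
      ∀ u ∈ U, ∃ v ∈ U, v ≠ u ∧ degIn G (F ∪ X) v ≠ 2) :
    A.card + 2 * T.card ≤ ∑ u ∈ F, degIn G T u + 2 * numEdgesIn G T := by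
  have hFT : ∀ u ∈ F, u ∉ T := fun u hu h => disjoint_left.1 hXF hu (hT.1 h)
  have hdegT : ∀ v ∈ T, 2 ≤ degIn G F v + degIn G T v := fun v hv => by
    rw [hT.degIn_eq hv]
    exact hdeg v hv
  have hsumT : ∑ v ∈ T, (degIn G F v + degIn G T v) =
      ∑ u ∈ F, degIn G T u + 2 * numEdgesIn G T := by
    rw [sum_add_distrib, sum_degIn_comm F T, sum_degIn]
  have h1 := sum_le_sum hdegT
  rw [hsumT, sum_const, smul_eq_mul] at h1
  have hsumA : ∑ u ∈ A, degIn G T u ≤ ∑ u ∈ F, degIn G T u := sum_le_sum_of_subset hAF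
  have h2 := sum_le_sum hA
  rw [sum_const, smul_eq_mul] at h2
  have h3 := hconn.card_le
  by_contra hlt
  -- `A = ∅` is settled by the minimum degree, and `|A| ≥ 2` by two edges per anchored vertex
  -- together with `|E[T]| ≥ |T| - 1`. For `A = {u}`, failure makes every estimate tight, so `T`
  -- with `u` is a semidisjoint cycle.
  have hA1 : A.card = 1 := by omega
  obtain ⟨u, rfl⟩ := card_eq_one.1 hA1
  rw [sum_singleton] at hsumA h2
  have huF : u ∈ F := hAF (mem_singleton_self u)
  have hu2 : degIn G T u = 2 := by rw [card_singleton] at *; omega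
  have htot : ∑ u ∈ F, degIn G T u + 2 * numEdgesIn G T = ∑ v ∈ T, 2 := by
    rw [sum_const, smul_eq_mul]
    rw [card_singleton] at *
    omega
  have hFsum : ∑ u ∈ F, degIn G T u = 2 := by rw [card_singleton] at *; omega
  have hall : ∀ v ∈ T, degIn G F v + degIn G T v = 2 := fun v hv =>
    (((sum_eq_sum_iff_of_le hdegT).1 (by rw [hsumT, htot])) v hv).symm
  have honly : ∀ f ∈ F, f ≠ u → degIn G T f = 0 := by
    intro f hf hfu
    have := sum_le_sum_of_subset (f := fun f => degIn G T f)
      (insert_subset hf (singleton_subset_iff.2 huF))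
    rw [sum_insert (by simpa using hfu), sum_singleton] at this
    omega
  have huT := hFT u huF
  have hcycle : InducesCycle G (insert u T) := by
    refine ⟨connected_induce_iff.2 ⟨⟨u, mem_insert_self _ _⟩, fun Q hQ ⟨q, hq⟩ => ?_⟩, ?_⟩
    · obtain ⟨w, hw, huw⟩ := degIn_pos_iff.1 (show 0 < degIn G T u by omega)
      have hmeet : (Q ∩ T).Nonempty := by
        rcases mem_insert.1 (hQ.1 hq) with rfl | h
        · exact ⟨w, mem_inter.2 ⟨hQ.2 q hq w (mem_insert_of_mem hw) huw, hw⟩⟩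
        · exact ⟨q, mem_inter.2 ⟨hq, h⟩⟩
      have hTQ : Q ∩ T = T := hconn.2 _ ⟨inter_subset_right, fun v hv x hx hvx =>
        mem_inter.2 ⟨hQ.2 v (mem_inter.1 hv).1 x (mem_insert_of_mem hx) hvx, hx⟩⟩ hmeet
      have hTQ' : T ⊆ Q := inter_eq_right.1 hTQ
      exact hQ.1.antisymm
        (insert_subset (hQ.2 w (hTQ' hw) u (mem_insert_self _ _) huw.symm) hTQ')
    · intro v hv
      rcases mem_insert.1 hv with rfl | hvT
      · rw [degIn_insert_self, hu2]
      · have hvF : degIn G F v = degIn G {u} v := degIn_congr fun w hvw => by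
          rw [mem_singleton]
          constructor
          · intro hw
            by_contra hwu
            have := degIn_pos_iff.2 ⟨v, hvT, hvw.symm⟩
            have := honly w hw hwu
            omega
          · rintro rfl
            exact huF
        have := hall v hvT
        rw [insert_eq, degIn_union (by simpa using huT)]
        omega
  obtain ⟨v, hv, hvu, hv2⟩ := hcyc (insert u T)
    (insert_subset (mem_union_left _ huF) (hT.1.trans subset_union_right)) hcycle u
    (mem_insert_self _ _)
  have hvT := (mem_insert.1 hv).resolve_left hvu
  rw [degIn_union hXF, ← hT.degIn_eq hvT] at hv2
  exact hv2 (hall v hvT)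

/-- Sums the bound for one component. A smallest nonempty closed subset is connected, so components
are peeled off without being enumerated; an anchor in `Y` lies in the peeled part or in the rest. -/
theorem card_anchored_add_le_of_closed {X F : Finset V} (hXF : Disjoint F X)
    (hdeg : ∀ v ∈ X, 2 ≤ degIn G F v + degIn G X v) {t : V → V}
    (ht : ∀ u ∈ F, ∀ Y, ClosedIn G X Y → t u ∈ Y → 2 ≤ degIn G Y u)
    (hcyc : ∀ U ⊆ F ∪ X, InducesCycle G U →
      ∀ u ∈ U, ∃ v ∈ U, v ≠ u ∧ degIn G (F ∪ X) v ≠ 2)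
    {Y : Finset V} (hY : ClosedIn G X Y) :
    (F.filter (fun u => t u ∈ Y)).card + 2 * Y.card ≤
      ∑ u ∈ F, degIn G Y u + 2 * numEdgesIn G Y := by
  induction Y using Finset.strongInduction with
  | H Y ih =>
    rcases Y.eq_empty_or_nonempty with rfl | hne
    · simp
    let P := Y.powerset.filter fun T => ClosedIn G X T ∧ T.Nonempty
    obtain ⟨T, hTP, hTmin⟩ := P.exists_min_image card ⟨Y, by simp [P, hY, hne]⟩
    simp only [P, mem_filter, mem_powerset] at hTP hTmin
    obtain ⟨hTY, hT, hTne⟩ := hTP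
    have hconn : CutConnected G T := by
      refine ⟨hTne, fun Q hQ hQne => eq_of_subset_of_card_le hQ.1 ?_⟩
      refine hTmin Q ⟨hQ.1.trans hTY, ⟨hQ.1.trans hT.1, fun v hv w hw hvw => ?_⟩, hQne⟩
      exact hQ.2 v hv w (hT.2 v (hQ.1 hv) w hw hvw) hvw
    have hsub : Y \ T ⊂ Y := sdiff_ssubset hTY hTne
    have h1 := ih (Y \ T) hsub (hY.sdiff hT)
    have h2 := card_anchored_add_le (A := F.filter (fun u => t u ∈ T)) hXF hT hconn
      (fun v hv => hdeg v (hT.1 hv)) (filter_subset _ _)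
      (fun u hu => ht u (mem_filter.1 hu).1 T hT (mem_filter.1 hu).2) hcyc
    have h3 : (F.filter (fun u => t u ∈ Y)).card ≤
        (F.filter (fun u => t u ∈ T)).card + (F.filter (fun u => t u ∈ Y \ T)).card := by
      refine (card_le_card fun u hu => ?_).trans (card_union_le _ _)
      simp only [mem_filter, mem_union, mem_sdiff] at hu ⊢
      tauto
    have h4 : T.card + (Y \ T).card = Y.card := by
      have := card_sdiff_add_card_eq_card hTY
      omega
    have h5 : ∑ u ∈ F, degIn G Y u = ∑ u ∈ F, degIn G T u + ∑ u ∈ F, degIn G (Y \ T) u := by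
      rw [← sum_add_distrib]
      refine sum_congr rfl fun u _ => ?_
      rw [← degIn_union disjoint_sdiff, union_sdiff_of_subset hTY]
    have h6 := numEdgesIn_union (G := G) (disjoint_sdiff (s := T) (t := Y))
    rw [union_sdiff_of_subset hTY] at h6
    omega

/-- In a graph of minimum degree two without semidisjoint cycles, a minimal feedback vertex set
`F` satisfies `∑ u ∈ F, (d(u) - 1) ≤ 2 (|E| - |V|)`. -/
theorem IsMinimalFVS.sum_degIn_add_le {W F : Finset V} (hF : IsMinimalFVS G W F)
    (hdeg : ∀ v ∈ W, 2 ≤ degIn G W v)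
    (hcyc : ∀ U ⊆ W, InducesCycle G U → ∀ u ∈ U, ∃ v ∈ U, v ≠ u ∧ degIn G W v ≠ 2) :
    ∑ u ∈ F, degIn G W u + 2 * W.card ≤ F.card + 2 * numEdgesIn G W := by
  have hW : F ∪ W \ F = W := union_sdiff_of_subset hF.subset
  have hdisj : Disjoint F (W \ F) := disjoint_sdiff
  choose! t htX ht using fun u (hu : u ∈ F) => hF.exists_anchor hu
  have h1 := card_anchored_add_le_of_closed (X := W \ F) (t := t) hdisj
    (fun v hv => by rw [← degIn_union hdisj, hW]; exact hdeg v (sdiff_subset hv)) ht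
    (by rw [hW]; exact hcyc) ⟨Subset.rfl, fun _ _ w hw _ => hw⟩
  rw [filter_true_of_mem htX] at h1
  have h2 := numEdgesIn_union (G := G) hdisj
  have h3 : ∑ u ∈ F, degIn G W u = ∑ u ∈ F, degIn G F u + ∑ u ∈ F, degIn G (W \ F) u := by
    rw [← sum_add_distrib]
    refine sum_congr rfl fun u _ => ?_
    rw [← degIn_union hdisj, hW]
  rw [sum_degIn] at h3
  rw [hW] at h2
  have h4 := card_sdiff_add_card_eq_card hF.subset
  omega

theorem IsMinimalFVS.of_erase_of_coreFree {W F : Finset V} {w : V}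
    (hF : IsMinimalFVS G (W.erase w) F) (h : CoreFree G (W \ F)) : IsMinimalFVS G W F where
  subset := hF.subset.trans (erase_subset _ _)
  coreFree := h
  minimal u hu hc := hF.minimal u hu
    (hc.mono (insert_subset_insert _ (sdiff_subset_sdiff (erase_subset _ _) Subset.rfl)))

/-- Putting `w` into `F` leaves the same forest, so minimality is new only at `w`, where it is the
hypothesis. -/
theorem IsMinimalFVS.insert_of_not_coreFree {W F : Finset V} {w : V} (hw : w ∈ W)
    (hF : IsMinimalFVS G (W.erase w) F) (h : ¬ CoreFree G (W \ F)) :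
    IsMinimalFVS G W (insert w F) := by
  have heq : W \ insert w F = W.erase w \ F := by
    ext x
    simp only [mem_sdiff, mem_insert, mem_erase]
    tauto
  have hwF : w ∉ F := fun h => by simpa using hF.subset h
  refine ⟨insert_subset hw (hF.subset.trans (erase_subset _ _)), heq ▸ hF.coreFree, ?_⟩
  intro u hu
  rw [heq]
  rcases mem_insert.1 hu with rfl | hu
  · convert h using 2
    ext x
    simp only [mem_sdiff, mem_insert, mem_erase]
    constructor
    · rintro (rfl | h)
      · exact ⟨hw, hwF⟩
      · exact ⟨h.1.2, h.2⟩
    · tauto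
  · exact hF.minimal u hu

/-! ### The local ratio argument -/

/-- Some weighting is paid for by the relaxation within a factor two, simultaneously for all
minimal feedback vertex sets. -/
theorem exists_good_weights {x : V → ℝ} (hx : x ∈ weakDensity G ∩ cycleCover G) {W : Finset V}
    (hW : W.Nonempty) (hdeg : ∀ v ∈ W, 2 ≤ degIn G W v) :
    ∃ g : V → ℝ, (∀ v ∈ W, 0 ≤ g v) ∧ (∃ v ∈ W, 0 < g v) ∧
      ∀ F, IsMinimalFVS G W F → ∑ u ∈ F, g u ≤ 2 * ∑ u ∈ W, g u * x u := by
  obtain ⟨⟨hx0, hwd⟩, -, hcc⟩ := hx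
  by_cases hsemi : ∃ U ⊆ W, InducesCycle G U ∧ ∃ u ∈ U, ∀ v ∈ U, v ≠ u → degIn G W v = 2
  · obtain ⟨U, hUW, hU, u₀, hu₀, hd⟩ := hsemi
    refine ⟨fun v => if v ∈ U then 1 else 0, fun v _ => by dsimp only; split_ifs <;> norm_num,
      ⟨u₀, hUW hu₀, by simp [hu₀]⟩, fun F hF => ?_⟩
    -- Here `g(F) ≤ 1 ≤ ∑ g x`, so the factor two is not even needed.
    have h1 := hF.card_inter_le_one hUW hU hd
    have h2 := hcc U hU
    simp only [ite_mul, one_mul, zero_mul]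
    rw [sum_ite_mem, sum_ite_mem, inter_eq_right.2 hUW]
    have h3 : ((F ∩ U).card : ℝ) ≤ 1 := by exact_mod_cast h1
    simp only [sum_const, nsmul_eq_mul, mul_one]
    linarith
  · push Not at hsemi
    have hdR : ∀ v ∈ W, (2 : ℝ) ≤ degIn G W v := fun v hv => by exact_mod_cast hdeg v hv
    obtain ⟨v₀, hv₀⟩ := hW
    refine ⟨fun v => (degIn G W v : ℝ) - 1, fun v hv => by have := hdR v hv; linarith,
      ⟨v₀, hv₀, by have := hdR v₀ hv₀; linarith⟩, fun F hF => ?_⟩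
    have h1 := hF.sum_degIn_add_le hdeg hsemi
    have h2 := hwd W
    have h3 : (∑ u ∈ F, (degIn G W u : ℝ)) + 2 * W.card ≤ F.card + 2 * numEdgesIn G W := by
      exact_mod_cast h1
    simp only [sum_sub_distrib, sum_const, nsmul_eq_mul, mul_one]
    linarith

theorem exists_minimalFVS_le_two_mul {x : V → ℝ} (hx : x ∈ weakDensity G ∩ cycleCover G)
    (W : Finset V) (c : V → ℝ) (hc : ∀ v ∈ W, 0 ≤ c v) :
    ∃ F, IsMinimalFVS G W F ∧ ∑ u ∈ F, c u ≤ 2 * ∑ u ∈ W, c u * x u := by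
  induction W using Finset.strongInduction generalizing c with
  | H W ih =>
    rcases W.eq_empty_or_nonempty with rfl | hne
    · refine ⟨∅, ⟨Subset.rfl, fun S hS h => ?_, by simp⟩, by simp⟩
      have := hS h.1.choose_spec
      simp at this
    by_cases hdeg : ∀ v ∈ W, 2 ≤ degIn G W v
    · obtain ⟨g, hg0, ⟨v₀, hv₀, hgv₀⟩, hg⟩ := exists_good_weights hx hne hdeg
      -- The least ratio `c / g` is the largest multiple of `g` that keeps the costs nonnegative; it
      -- makes `w` free.
      obtain ⟨w, hwP, hmin⟩ := (W.filter fun v => 0 < g v).exists_min_image (fun v => c v / g v)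
        ⟨v₀, mem_filter.2 ⟨hv₀, hgv₀⟩⟩
      obtain ⟨hw, hgw⟩ := mem_filter.1 hwP
      have hε : 0 ≤ c w / g w := div_nonneg (hc w hw) hgw.le
      set ε := c w / g w with hεdef
      have hc' : ∀ v ∈ W, 0 ≤ c v - ε * g v := by
        intro v hv
        rcases (hg0 v hv).eq_or_lt with h | h
        · rw [← h]
          simpa using hc v hv
        · have := (le_div_iff₀ h).1 (hmin v (mem_filter.2 ⟨hv, h⟩))
          linarith
      have hcw : c w - ε * g w = 0 := by
        rw [hεdef]
        field_simp
        ring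
      obtain ⟨F, hF, hle⟩ := ih _ (erase_ssubset hw) (fun v => c v - ε * g v)
        (fun v hv => hc' v (mem_of_mem_erase hv))
      have hsumW : ∑ u ∈ W.erase w, (c u - ε * g u) * x u = ∑ u ∈ W, (c u - ε * g u) * x u := by
        rw [← add_sum_erase W _ hw, hcw]
        ring
      have hfinish : ∀ F', IsMinimalFVS G W F' →
          ∑ u ∈ F', (c u - ε * g u) = ∑ u ∈ F, (c u - ε * g u) →
          ∃ F, IsMinimalFVS G W F ∧ ∑ u ∈ F, c u ≤ 2 * ∑ u ∈ W, c u * x u := by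
        intro F' hF' heq
        refine ⟨F', hF', ?_⟩
        have h1 := mul_le_mul_of_nonneg_left (hg F' hF') hε
        rw [← heq, hsumW] at hle
        simp only [sub_mul, sum_sub_distrib, mul_assoc, ← mul_sum] at hle
        linarith
      by_cases hcf : CoreFree G (W \ F)
      · exact hfinish F (hF.of_erase_of_coreFree hcf) rfl
      · refine hfinish _ (hF.insert_of_not_coreFree hw hcf) ?_
        rw [sum_insert (fun h => by simpa using hF.subset h), hcw, zero_add]
    · push Not at hdeg
      obtain ⟨v, hv, hd⟩ := hdeg
      obtain ⟨F, hF, hle⟩ := ih _ (erase_ssubset hv) c (fun v hv => hc v (mem_of_mem_erase hv))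
      -- A vertex of degree at most one lies in no core, so restoring it creates no cycle.
      refine ⟨F, hF.of_erase_of_coreFree fun S hS hcore => hF.coreFree S (fun y hy => ?_) hcore,
        ?_⟩
      · have hyW := mem_sdiff.1 (hS hy)
        refine mem_sdiff.2 ⟨mem_erase.2 ⟨?_, hyW.1⟩, hyW.2⟩
        rintro rfl
        have := degIn_mono (G := G) (hS.trans sdiff_subset) y
        have := hcore.2 y hy
        omega
      · rw [← add_sum_erase W _ hv]
        have := mul_nonneg (hc v hv) (hx.1.1 v)
        linarith

/-! ### The integer program -/

theorem charVec_mem [Fintype V] {F : Finset V} (hF : IsFeedbackVertexSet G F) :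
    charVec F ∈ weakDensity G ∩ cycleCover G := by
  rw [isFeedbackVertexSet_iff] at hF
  have h0 : ∀ u, 0 ≤ charVec F u := fun u => by unfold charVec; split_ifs <;> norm_num
  refine ⟨⟨h0, fun S => ?_⟩, h0, fun U hU => ?_⟩
  · have h1 := numEdgesIn_le_sum_degIn_add (G := G) (inter_subset_left : S ∩ F ⊆ S)
    rw [sdiff_inter_self_left] at h1
    have h2 := (hF.mono (sdiff_subset_sdiff (subset_univ S) (Subset.refl F))).numEdgesIn_le
    have h3 := card_sdiff_add_card_inter S F
    have h4 : (numEdgesIn G S : ℝ) + (S ∩ F).card ≤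
        (∑ u ∈ S ∩ F, (degIn G S u : ℝ)) + S.card := by
      exact_mod_cast (by omega :
        numEdgesIn G S + (S ∩ F).card ≤ ∑ u ∈ S ∩ F, degIn G S u + S.card)
    have h5 : ∑ u ∈ S, ((degIn G S u : ℝ) - 1) * charVec F u =
        ∑ u ∈ S ∩ F, ((degIn G S u : ℝ) - 1) := by
      simp only [charVec, mul_ite, mul_one, mul_zero]
      rw [sum_ite_mem]
    rw [h5, sum_sub_distrib]
    simp only [sum_const, nsmul_eq_mul, mul_one]
    linarith
  · obtain ⟨v, hvU, hvF⟩ : ∃ v ∈ U, v ∈ F := by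
      by_contra hno
      push Not at hno
      exact hF U (fun v hv => by simpa using hno v hv) hU.isCore
    refine le_trans ?_ (single_le_sum (fun u _ => h0 u) hvU)
    simp [charVec, hvF]

/-- This is weak density for a singleton. It makes integer points 0/1 and the relaxation compact, so
minima exist. -/
theorem le_one_of_mem_weakDensity {x : V → ℝ} (hx : x ∈ weakDensity G) (u : V) : x u ≤ 1 := by
  have h := hx.2 {u}
  have h1 : degIn G {u} u = 0 := by simp [degIn]
  simp only [card_singleton, sum_singleton, h1, Nat.cast_zero, Nat.cast_one] at h
  have h2 : (0 : ℝ) ≤ numEdgesIn G {u} := Nat.cast_nonneg _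
  linarith

theorem feasible_eq [Fintype V] :
    weakDensity G ∩ cycleCover G ∩ integerVectors V =
      {x | ∃ F : Finset V, IsFeedbackVertexSet G F ∧ x = charVec F} := by
  ext x
  constructor
  · rintro ⟨⟨hwd, hcc⟩, hint⟩
    have h01 : ∀ u, x u = 0 ∨ x u = 1 := by
      intro u
      obtain ⟨k, hk⟩ := hint u
      have h0 := hwd.1 u
      have h1 := le_one_of_mem_weakDensity hwd u
      rw [hk] at h0 h1 ⊢
      norm_cast at *
      omega
    have hchar : x = charVec (univ.filter fun u => x u = 1) := by
      funext u
      rcases h01 u with h | h <;> simp [charVec, h]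
    refine ⟨univ.filter fun u => x u = 1, ?_, hchar⟩
    rw [isFeedbackVertexSet_iff]
    by_contra hc
    obtain ⟨U, hU, hUc⟩ := not_coreFree_iff.1 hc
    have h1 := hcc.2 U hUc
    rw [sum_eq_zero] at h1
    · norm_num at h1
    · intro u hu
      refine (h01 u).resolve_right fun h => ?_
      have := hU hu
      simp [h] at this
  · rintro ⟨F, hF, rfl⟩
    refine ⟨charVec_mem hF, fun u => ?_⟩
    unfold charVec
    split_ifs
    · exact ⟨1, by simp⟩
    · exact ⟨0, by simp⟩

theorem objective_charVec [Fintype V] (c : V → ℝ) (F : Finset V) :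
    objective c (charVec F) = ∑ u ∈ F, c u := by
  simp [objective, charVec]

theorem image_objective_feasible [Fintype V] (G : SimpleGraph V) (c : V → ℝ) :
    objective c '' (weakDensity G ∩ cycleCover G ∩ integerVectors V) =
      {t | ∃ F : Finset V, IsFeedbackVertexSet G F ∧ t = ∑ u ∈ F, c u} := by
  rw [feasible_eq]
  ext t
  constructor
  · rintro ⟨_, ⟨F, hF, rfl⟩, rfl⟩
    exact ⟨F, hF, objective_charVec c F⟩
  · rintro ⟨F, hF, rfl⟩
    exact ⟨_, ⟨F, hF, rfl⟩, objective_charVec c F⟩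

theorem isFeedbackVertexSet_univ [Fintype V] (G : SimpleGraph V) :
    IsFeedbackVertexSet G univ := by
  rw [isFeedbackVertexSet_iff]
  intro S hS h
  obtain ⟨v, hv⟩ := h.1
  simpa using hS hv

theorem exists_isMinFVSCost [Fintype V] (G : SimpleGraph V) (c : V → ℝ) :
    ∃ z, IsMinFVSCost G c z := by
  obtain ⟨F, hF, hmin⟩ := (univ.filter fun F : Finset V => IsFeedbackVertexSet G F).exists_min_image
    (fun F => ∑ u ∈ F, c u) ⟨univ, by simp [isFeedbackVertexSet_univ]⟩
  refine ⟨∑ u ∈ F, c u, ⟨F, (mem_filter.1 hF).2, rfl⟩, ?_⟩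
  rintro _ ⟨F', hF', rfl⟩
  exact hmin F' (by simp [hF'])

theorem isCompact_relaxation (G : SimpleGraph V) :
    IsCompact (weakDensity G ∩ cycleCover G) := by
  refine IsCompact.of_isClosed_subset
    (isCompact_univ_pi fun _ : V => isCompact_Icc (a := (0 : ℝ)) (b := 1)) ?_ fun x hx u _ =>
      ⟨hx.1.1 u, le_one_of_mem_weakDensity hx.1 u⟩
  have hnn : IsClosed {x : V → ℝ | ∀ u, 0 ≤ x u} := by
    simp only [Set.ofPred_forall]
    exact isClosed_iInter fun u => isClosed_le continuous_const (continuous_apply u)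
  have hwd : IsClosed {x : V → ℝ | ∀ S : Finset V,
      (numEdgesIn G S : ℝ) - (S.card : ℝ) ≤ ∑ u ∈ S, ((degIn G S u : ℝ) - 1) * x u} := by
    simp only [Set.ofPred_forall]
    exact isClosed_iInter fun S => isClosed_le continuous_const (by fun_prop)
  have hcc : IsClosed {x : V → ℝ | ∀ U : Finset V, InducesCycle G U → 1 ≤ ∑ u ∈ U, x u} := by
    simp only [Set.ofPred_forall]
    exact isClosed_iInter fun S => isClosed_iInter fun _ =>
      isClosed_le continuous_const (by fun_prop)
  exact (hnn.inter hwd).inter (hnn.inter hcc)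

theorem exists_isMinValue_relaxation [Fintype V] (G : SimpleGraph V) (c : V → ℝ) :
    ∃ z, IsMinValue c (weakDensity G ∩ cycleCover G) z := by
  have hcont : Continuous (objective c : (V → ℝ) → ℝ) := by
    unfold objective
    fun_prop
  exact ((isCompact_relaxation G).image hcont).exists_isLeast
    (Set.Nonempty.image _ ⟨_, charVec_mem (isFeedbackVertexSet_univ G)⟩)

theorem isILPFormulation [Fintype V] (G : SimpleGraph V) (c : V → ℝ) :
    IsILPFormulation G c (weakDensity G ∩ cycleCover G) := by
  obtain ⟨z, hz⟩ := exists_isMinFVSCost G c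
  refine ⟨feasible_eq, z, ?_, hz⟩
  unfold IsMinValue
  rw [image_objective_feasible]
  exact hz

theorem integralityGapLE_two [Fintype V] (G : SimpleGraph V) {c : V → ℝ} (hc : ∀ v, 0 ≤ c v) :
    IntegralityGapLE c (weakDensity G ∩ cycleCover G) 2 := by
  obtain ⟨zIP, hIP⟩ := exists_isMinFVSCost G c
  obtain ⟨zLP, hLP⟩ := exists_isMinValue_relaxation G c
  refine ⟨zIP, zLP, ?_, hLP, ?_⟩
  · unfold IsMinValue
    rw [image_objective_feasible]
    exact hIP
  · obtain ⟨x, hx, rfl⟩ := hLP.1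
    obtain ⟨F, hF, hle⟩ := exists_minimalFVS_le_two_mul hx univ c fun v _ => hc v
    exact (hIP.2 ⟨F, isFeedbackVertexSet_iff.2 hF.coreFree, rfl⟩).trans hle

/-! ### The extended formulation of the cycle cover polyhedron -/

/-- Vertex sets grown from `s` along edges of `G`, never stepping from `s` to `t`. -/
inductive Grown (G : SimpleGraph V) (s t : V) : Finset V → Prop
  | singleton : Grown G s t {s}
  | step {Y : Finset V} {a b : V} : Grown G s t Y → a ∈ Y → b ∉ Y → G.Adj a b →
      ¬ (a = s ∧ b = t) → Grown G s t (insert b Y)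

theorem Grown.start_mem {s t : V} {Y : Finset V} (h : Grown G s t Y) : s ∈ Y := by
  induction h with
  | singleton => exact mem_singleton_self _
  | step _ _ _ _ _ ih => exact mem_insert_of_mem ih

/-- Each step adds a vertex and at least one edge. The step that reaches `t` comes from some `a ≠
s`, so it adds the edge `st` as well, closing a cycle. -/
theorem Grown.card_le {s t : V} (hst : G.Adj s t) {Y : Finset V} (h : Grown G s t Y) :
    Y.card + (if t ∈ Y then 1 else 0) ≤ numEdgesIn G Y + 1 := by
  induction h with
  | singleton => simp [hst.ne']
  | @step Y a b hY ha hb hab hne ih =>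
    rw [card_insert_of_notMem hb, numEdgesIn_insert hb]
    have h1 : 0 < degIn G Y b := degIn_pos_iff.2 ⟨a, ha, hab.symm⟩
    by_cases hbt : b = t
    · subst hbt
      have has : a ≠ s := fun h => hne ⟨h, rfl⟩
      have h2 : ({a, s} : Finset V) ⊆ Y.filter (fun x => G.Adj b x) := by
        intro x hx
        simp only [mem_insert, mem_singleton] at hx
        rcases hx with rfl | rfl
        · exact mem_filter.2 ⟨ha, hab.symm⟩
        · exact mem_filter.2 ⟨hY.start_mem, hst.symm⟩
      have h3 : 2 ≤ degIn G Y b := (card_pair has).ge.trans (card_le_card h2)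
      rw [if_neg hb] at ih
      rw [if_pos (mem_insert_self _ _)]
      omega
    · have : (t ∈ insert b Y) ↔ t ∈ Y := by
        rw [mem_insert]
        exact or_iff_right fun h => hbt h.symm
      simp only [this]
      omega

theorem Grown.one_le_sum {x : V → ℝ} (hx : x ∈ cycleCover G) {s t : V} (hst : G.Adj s t)
    {Y : Finset V} (h : Grown G s t Y) (ht : t ∈ Y) : 1 ≤ ∑ u ∈ Y, x u := by
  have h1 := h.card_le hst
  rw [if_pos ht] at h1
  have h2 : ¬ CoreFree G Y := fun hc => by
    have := hc.numEdgesIn_lt ⟨t, ht⟩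
    omega
  obtain ⟨U, hUY, hU⟩ := not_coreFree_iff.1 h2
  exact (hx.2 U hU).trans (sum_le_sum_of_subset_of_nonneg hUY fun u _ _ => hx.1 u)

/-- The potential of `w`: the least weight of a grown set containing `w`, capped at one. -/
noncomputable def potential [Fintype V] (G : SimpleGraph V) (x : V → ℝ) (s t w : V) : ℝ :=
  (univ : Finset (Finset V)).inf' univ_nonempty
    fun Y => if Grown G s t Y ∧ w ∈ Y then ∑ u ∈ Y, x u else 1

theorem potential_le_sum [Fintype V] {x : V → ℝ} {s t w : V} {Y : Finset V}
    (h : Grown G s t Y) (hw : w ∈ Y) : potential G x s t w ≤ ∑ u ∈ Y, x u :=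
  (inf'_le _ (mem_univ Y)).trans_eq (if_pos ⟨h, hw⟩)

theorem potential_le_one [Fintype V] (x : V → ℝ) (s t w : V) : potential G x s t w ≤ 1 :=
  (inf'_le _ (mem_univ ∅)).trans_eq (if_neg fun h => by simpa using h.2)

theorem potential_start_le [Fintype V] (x : V → ℝ) (s t : V) : potential G x s t s ≤ x s := by
  simpa using potential_le_sum (x := x) (Grown.singleton (G := G) (s := s) (t := t))
    (mem_singleton_self s)

theorem one_le_potential [Fintype V] {x : V → ℝ} (hx : x ∈ cycleCover G) {s t : V}
    (hst : G.Adj s t) : 1 ≤ potential G x s t t := by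
  refine le_inf' _ _ fun Y _ => ?_
  split_ifs with h
  · exact h.1.one_le_sum hx hst h.2
  · exact le_rfl

theorem potential_step [Fintype V] {x : V → ℝ} (hx : ∀ u, 0 ≤ x u) {s t a b : V}
    (hab : G.Adj a b) (hne : ¬ (a = s ∧ b = t)) :
    potential G x s t b ≤ x b + potential G x s t a := by
  -- Minimise over the sets reaching `a`: each either contains `b` or can be grown by it. The cap at
  -- one covers the sets that do not qualify.
  rw [← sub_le_iff_le_add']
  refine le_inf' _ _ fun Y _ => ?_
  rw [sub_le_iff_le_add']
  split_ifs with h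
  · by_cases hb : b ∈ Y
    · have := potential_le_sum (x := x) h.1 hb
      have := hx b
      linarith
    · have := potential_le_sum (x := x) (h.1.step h.2 hb hab hne) (mem_insert_self _ _)
      rwa [sum_insert hb] at this
  · have := potential_le_one (G := G) x s t b
    have := hx b
    linarith

/-- Feasible potentials on all edges certify that every induced cycle is covered. -/
theorem mem_cycleCover_of_potentials {x : V → ℝ} (hx : ∀ u, 0 ≤ x u) {d : V → V → V → ℝ}
    (hs : ∀ s t, G.Adj s t → d s t s ≤ x s) (ht : ∀ s t, G.Adj s t → 1 ≤ d s t t)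
    (hstep : ∀ s t a b, G.Adj s t → G.Adj a b → ¬ (a = s ∧ b = t) →
      d s t b ≤ x b + d s t a) :
    x ∈ cycleCover G := by
  refine ⟨hx, fun U hU => ?_⟩
  obtain ⟨s, hsU⟩ := hU.isCore.1
  obtain ⟨t, htU, hst⟩ := degIn_pos_iff.1 (show 0 < degIn G U s by rw [hU.2 s hsU]; omega)
  -- A largest such `R` is all of `U`: otherwise one of the two or more cycle edges leaving it is
  -- not the step from `s` to `t`, and the step inequality extends `R`.
  let P := U.powerset.filter fun R => s ∈ R ∧ ∀ w ∈ R, d s t w ≤ ∑ u ∈ R, x u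
  obtain ⟨R, hRP, hmax⟩ := P.exists_max_image card ⟨{s}, by simp [P, hsU, hs s t hst]⟩
  simp only [P, mem_filter, mem_powerset] at hRP hmax
  obtain ⟨hRU, hsR, hR⟩ := hRP
  have hRU' : R = U := by
    by_contra hne
    obtain ⟨a, ha, b, hb, hbR, hab, hne⟩ := hU.exists_exit hRU ⟨s, hsR⟩ hne s t
    have h1 := hmax (insert b R) ⟨insert_subset hb hRU, mem_insert_of_mem hsR, fun w hw => by
      rw [sum_insert hbR]
      rcases mem_insert.1 hw with rfl | hw
      · have := hstep s t a w hst hab hne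
        have := hR a ha
        linarith
      · have := hR w hw
        have := hx b
        linarith⟩
    rw [card_insert_of_notMem hbR] at h1
    omega
  subst hRU'
  exact (ht s t hst).trans (hR t htU)

/-- The constraints of the system of potentials: nonnegativity, the start and end conditions of
each edge, and the step conditions of each pair of edges. -/
abbrev PotentialCon (V : Type u) : Type u := V ⊕ (V × V) ⊕ (V × V) ⊕ (V × V × V × V)

/-- The coefficients of the original variables in the system of potentials. -/
noncomputable def potentialA (G : SimpleGraph V) : PotentialCon V → V → ℤ
  | .inl v, w => if w = v then 1 else 0
  | .inr (.inl (s, t)), w => if G.Adj s t then (if w = s then 1 else 0) else 0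
  | .inr (.inr (.inl _)), _ => 0
  | .inr (.inr (.inr (s, t, a, b))), w =>
    if G.Adj s t ∧ G.Adj a b ∧ ¬ (a = s ∧ b = t) then (if w = b then 1 else 0) else 0

/-- The coefficients of the potentials in the system of potentials. -/
noncomputable def potentialB (G : SimpleGraph V) : PotentialCon V → V × V × V → ℤ
  | .inl _, _ => 0
  | .inr (.inl (s, t)), j => if G.Adj s t then (if j = (s, t, s) then -1 else 0) else 0
  | .inr (.inr (.inl (s, t))), j => if G.Adj s t then (if j = (s, t, t) then 1 else 0) else 0
  | .inr (.inr (.inr (s, t, a, b))), j =>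
    if G.Adj s t ∧ G.Adj a b ∧ ¬ (a = s ∧ b = t) then
      (if j = (s, t, a) then 1 else 0) - (if j = (s, t, b) then 1 else 0) else 0

/-- The right-hand sides of the system of potentials. -/
noncomputable def potentialRhs (G : SimpleGraph V) : PotentialCon V → ℤ
  | .inr (.inr (.inl (s, t))) => if G.Adj s t then 1 else 0
  | _ => 0

/-- The system of potentials describing the cycle cover polyhedron. -/
noncomputable def cycleCoverSystem [Fintype V] (G : SimpleGraph V) : ExtendedFormulation V where
  Aux := V × V × V
  Con := PotentialCon V
  A := potentialA G
  B := potentialB G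
  b := potentialRhs G

theorem mem_projection_cycleCoverSystem [Fintype V] {x : V → ℝ} :
    x ∈ (cycleCoverSystem G).projection ↔ ∃ y : V × V × V → ℝ,
      (∀ v, 0 ≤ x v) ∧ (∀ s t, G.Adj s t → y (s, t, s) ≤ x s) ∧
      (∀ s t, G.Adj s t → 1 ≤ y (s, t, t)) ∧
      ∀ s t a b, G.Adj s t → G.Adj a b → ¬ (a = s ∧ b = t) →
        y (s, t, b) ≤ x b + y (s, t, a) := by
  refine exists_congr fun (y : V × V × V → ℝ) => ?_
  have hite : ∀ (f : V × V × V → ℝ) (p q : V × V × V),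
      ∑ j, ((if j = p then (1 : ℝ) else 0) - (if j = q then 1 else 0)) * f j = f p - f q := by
    intro f p q
    simp [sub_mul]
  have h1 : ∀ v, (potentialRhs G (.inl v) : ℝ) ≤
      ∑ w, (potentialA G (.inl v) w : ℝ) * x w +
        ∑ j, (potentialB G (.inl v) j : ℝ) * y j ↔ 0 ≤ x v := by
    intro v
    simp [potentialA, potentialB, potentialRhs]
  have h2 : ∀ s t, (potentialRhs G (.inr (.inl (s, t))) : ℝ) ≤
      ∑ w, (potentialA G (.inr (.inl (s, t))) w : ℝ) * x w +
        ∑ j, (potentialB G (.inr (.inl (s, t))) j : ℝ) * y j ↔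
      (G.Adj s t → y (s, t, s) ≤ x s) := by
    intro s t
    by_cases h : G.Adj s t <;> simp [potentialA, potentialB, potentialRhs, h]
  have h3 : ∀ s t, (potentialRhs G (.inr (.inr (.inl (s, t)))) : ℝ) ≤
      ∑ w, (potentialA G (.inr (.inr (.inl (s, t)))) w : ℝ) * x w +
        ∑ j, (potentialB G (.inr (.inr (.inl (s, t)))) j : ℝ) * y j ↔
      (G.Adj s t → 1 ≤ y (s, t, t)) := by
    intro s t
    by_cases h : G.Adj s t <;> simp [potentialA, potentialB, potentialRhs, h]
  have h4 : ∀ s t a b, (potentialRhs G (.inr (.inr (.inr (s, t, a, b)))) : ℝ) ≤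
      ∑ w, (potentialA G (.inr (.inr (.inr (s, t, a, b)))) w : ℝ) * x w +
        ∑ j, (potentialB G (.inr (.inr (.inr (s, t, a, b)))) j : ℝ) * y j ↔
      (G.Adj s t → G.Adj a b → ¬ (a = s ∧ b = t) → y (s, t, b) ≤ x b + y (s, t, a)) := by
    intro s t a b
    by_cases h : G.Adj s t ∧ G.Adj a b ∧ ¬ (a = s ∧ b = t)
    · simp only [potentialA, potentialB, potentialRhs, if_pos h]
      push_cast
      rw [hite]
      simp only [ite_mul, one_mul, zero_mul, sum_ite_eq', mem_univ, if_true]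
      constructor
      · intro h' _ _ _
        linarith
      · intro h'
        have := h' h.1 h.2.1 h.2.2
        linarith
    · simp only [potentialA, potentialB, potentialRhs, if_neg h]
      simp only [Int.cast_zero, zero_mul, sum_const_zero, add_zero, le_refl, true_iff]
      exact fun ha hb hc => absurd ⟨ha, hb, hc⟩ h
  constructor
  · intro h
    exact ⟨fun v => (h1 v).1 (h (.inl v)), fun s t => (h2 s t).1 (h (.inr (.inl (s, t)))),
      fun s t => (h3 s t).1 (h (.inr (.inr (.inl (s, t))))),
      fun s t a b => (h4 s t a b).1 (h (.inr (.inr (.inr (s, t, a, b)))))⟩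
  · rintro ⟨k1, k2, k3, k4⟩ (v | ⟨s, t⟩ | ⟨s, t⟩ | ⟨s, t, a, b⟩)
    · exact (h1 v).2 (k1 v)
    · exact (h2 s t).2 (k2 s t)
    · exact (h3 s t).2 (k3 s t)
    · exact (h4 s t a b).2 (k4 s t a b)

theorem projection_cycleCoverSystem [Fintype V] (G : SimpleGraph V) :
    (cycleCoverSystem G).projection = cycleCover G := by
  ext x
  rw [mem_projection_cycleCoverSystem]
  constructor
  · rintro ⟨y, h1, h2, h3, h4⟩
    exact mem_cycleCover_of_potentials h1 (d := fun s t w => y (s, t, w)) h2 h3 h4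
  · intro hx
    exact ⟨fun j => potential G x j.1 j.2.1 j.2.2, hx.1, fun s t _ => potential_start_le x s t,
      fun s t h => one_le_potential hx h, fun s t a b _ hab hne => potential_step hx.1 hab hne⟩

/-! ### Size of the system of potentials -/

theorem intSize_le_two {k : ℤ} (hk : k.natAbs ≤ 1) : intSize k ≤ 2 := by
  have := Nat.size_le_size hk
  rw [Nat.size_one] at this
  unfold intSize
  omega

theorem ExtendedFormulation.size_le [Fintype V] (Φ : ExtendedFormulation V)
    (hA : ∀ i v, (Φ.A i v).natAbs ≤ 1) (hB : ∀ i j, (Φ.B i j).natAbs ≤ 1)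
    (hb : ∀ i, (Φ.b i).natAbs ≤ 1) :
    Φ.size ≤ (Fintype.card V + Fintype.card Φ.Aux) + Fintype.card Φ.Con +
      Fintype.card Φ.Con * (Fintype.card V * 2 + Fintype.card Φ.Aux * 2 + 2) := by
  unfold ExtendedFormulation.size
  gcongr
  rw [← smul_eq_mul, ← Finset.card_univ (α := Φ.Con)]
  refine sum_le_card_nsmul _ _ _ fun i _ => ?_
  refine Nat.add_le_add (Nat.add_le_add ?_ ?_) (intSize_le_two (hb i))
  · exact sum_le_card_nsmul _ _ _ fun v _ => intSize_le_two (hA i v)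
  · exact sum_le_card_nsmul _ _ _ fun j _ => intSize_le_two (hB i j)

theorem size_cycleCoverSystem_le [Fintype V] (G : SimpleGraph V) :
    (cycleCoverSystem G).size ≤
      (Fintype.card V + Fintype.card V ^ 3) +
        (Fintype.card V + 2 * Fintype.card V ^ 2 + Fintype.card V ^ 4) +
        (Fintype.card V + 2 * Fintype.card V ^ 2 + Fintype.card V ^ 4) *
          (Fintype.card V * 2 + Fintype.card V ^ 3 * 2 + 2) := by
  refine ((cycleCoverSystem G).size_le ?_ ?_ ?_).trans_eq ?_
  · rintro (v | ⟨s, t⟩ | ⟨s, t⟩ | ⟨s, t, a, b⟩) w <;> simp only [cycleCoverSystem, potentialA] <;>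
      (try split_ifs) <;> simp
  · rintro (v | ⟨s, t⟩ | ⟨s, t⟩ | ⟨s, t, a, b⟩) j <;> simp only [cycleCoverSystem, potentialB] <;>
      (try split_ifs) <;> simp
  · rintro (v | ⟨s, t⟩ | ⟨s, t⟩ | ⟨s, t, a, b⟩) <;> simp only [cycleCoverSystem, potentialRhs] <;>
      (try split_ifs) <;> simp
  · have h1 : Fintype.card (cycleCoverSystem G).Aux = Fintype.card V ^ 3 := by
      change Fintype.card (V × V × V) = _
      simp only [Fintype.card_prod]
      ring
    have h2 : Fintype.card (cycleCoverSystem G).Con =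
        Fintype.card V + 2 * Fintype.card V ^ 2 + Fintype.card V ^ 4 := by
      change Fintype.card (V ⊕ (V × V) ⊕ (V × V) ⊕ (V × V × V × V)) = _
      simp only [Fintype.card_prod, Fintype.card_sum]
      ring
    rw [h1, h2]

end FVS

theorem theorem2 :
    (∀ (V : Type u) [Fintype V] (G : SimpleGraph V) (c : V → ℝ), (∀ v, 0 ≤ c v) →
      FVS.IsILPFormulation G c (FVS.weakDensity G ∩ FVS.cycleCover G) ∧
      FVS.IntegralityGapLE c (FVS.weakDensity G ∩ FVS.cycleCover G) 2) ∧
    (∃ p : Polynomial ℕ, ∀ (V : Type u) [Fintype V] (G : SimpleGraph V),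
      ∃ Φ : FVS.ExtendedFormulation V,
        Φ.projection = FVS.cycleCover G ∧ Φ.size ≤ p.eval (Fintype.card V)) := by
  refine ⟨fun V _ G c hc => ⟨FVS.isILPFormulation G c, FVS.integralityGapLE_two G hc⟩,
    -- With `n = |V|` there are `n + n³` variables and `n + 2n² + n⁴` constraints, as non-edges keep
    -- trivial rows. All entries are in `{-1, 0, 1}` and cost at most two bits.
    (.X + .X ^ 3) + (.X + 2 * .X ^ 2 + .X ^ 4) +
      (.X + 2 * .X ^ 2 + .X ^ 4) * (.X * 2 + .X ^ 3 * 2 + 2), fun V _ G =>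
    ⟨FVS.cycleCoverSystem G, FVS.projection_cycleCoverSystem G,
      (FVS.size_cycleCoverSystem_le G).trans_eq ?_⟩⟩
  simp
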